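/- **Universal approximation by concrete (LN-free) Sessa networks with adapters.** *Blocks.* Fix $\vartheta>1$ (the RoPE base), an even $d_k\ge 2$, a width $m\ge 1$ and a length $T$. Sequences $x\in\mathbb R^{T\times m}$ have rows $x_t\in\mathbb R^m$, $t=0,\dots,T-1$. For $\tau\in\mathbb R$ and $z=(z^{(0)},\dots,z^{(d_k/2-1)})\in(\mathbb R^2)^{d_k/2}$ let $\mathrm{RoPE}_\tau(z)$ be obtained by rotating each $z^{(r)}$ by the angle $\vartheta^{-2r/d_k}\tau$. Let $\mathrm{GELU}(z)=z\,\Phi(z)$, $\Phi$ the standard normal distribution function, applied coordinatewise. An LN-free Sessa block of width $m$ is a map $x\mapsto y$ on $\mathbb R^{T\times m}$ given by parameters $W^{\mathrm{in}}\in\mathbb R^{m\times 2m}$, $b^{\mathrm{in}}\in\mathbb R^{2m}$, $W^{\mathrm{out}},W_V\in\mathbb R^{m\times m}$, $b^{\mathrm{out}},w^\gamma\in\mathbb R^m$, $W_{Qf},W_{Kf},W_{Qb},W_{Kb}\in\mathbb R^{m\times d_k}$, $b^\gamma\in\mathbb R$ as follows: $$(a_t,g_t)=x_tW^{\mathrm{in}}+b^{\mathrm{in}},\qquad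 \bar a_t=\mathrm{GELU}(a_t),\qquad \gamma_t=\tanh(\langle\bar a_t,w^\gamma\rangle+b^\gamma),$$ $$f_t=\sum_{j\le t}\alpha^f_{t,j}\,\bar a_jW_V,\qquad \alpha^f_{t,\cdot}=\operatorname{softmax}_{0\le j\le t}\Big(d_k^{-1/2}\langle\mathrm{RoPE}_t(\bar a_tW_{Qf}),\mathrm{RoPE}_j(\bar a_jW_{Kf})\rangle\Big),$$ $$\alpha^b_{t,\cdot}=\operatorname{softmax}_{0\le j<t}\Big(d_k^{-1/2}\langle\bar a_tW_{Qb},\bar a_jW_{Kb}\rangle\Big),\qquad B_{t,j}=\gamma_t\alpha^b_{t,j}\ (j<t),\quad B_{t,j}=0\ (j\ge t),$$ $s\in\mathbb R^{T\times m}$ is the unique solution of $(I-B)s=f$, and $y_t=x_t+(s_t\odot g_t)W^{\mathrm{out}}+b^{\mathrm{out}}$. An LN-free Sessa network of width $m$ is a composition $G_N\circ\cdots\circ G_1$, $N\ge 1$, of such blocks, all with the same $\vartheta$, $d_k$ and $m$. *Causality.* For $\mathcal D\subset\mathbb R^{T\times D}$, a map $F:\mathcal D\to\mathbb R^{T\times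 D}$ is causal if for every $t$ and all $x,x'\in\mathcal D$ with $x_s=x'_s$ for all $s\le t$ one has $F(x)_t=F(x')_t$. **Theorem.** Let $\vartheta>1$, let $\mathcal D\subset\mathbb R^{T\times D}$ be compact and let $F:\mathcal D\to\mathbb R^{T\times D}$ be continuous and causal. Then for every $\varepsilon>0$ there are a width $m\ge\max(D,1)$, tokenwise affine adapters $$\mathrm{Embed}(x)_t=x_tW^{\mathrm{emb}}+b^{\mathrm{emb}}\in\mathbb R^m,\qquad \mathrm{Unembed}(h)_t=h_tW^{\mathrm{un}}+b^{\mathrm{un}}\in\mathbb R^D$$ with $\mathrm{Unembed}\circ\mathrm{Embed}=\mathrm{Id}$ on $\mathbb R^{T\times D}$, and an LN-free Sessa network $G$ of width $m$ with $d_k=2$ such that $$\sup_{x\in\mathcal D}\big\|F(x)-\mathrm{Unembed}(G(\mathrm{Embed}(x)))\big\|_F<\varepsilon .$$ -/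

import Mathlib

/-!
Concrete Sessa blocks and networks without LayerNorm.

A sequence of `T` tokens in `ℝ^m` is a matrix with rows indexed by `Fin T`; linear maps act on
rows from the right.  Query and key vectors lie in `ℝ^{d_k}` with `d_k = 2 * p` even, written as `p`
consecutive pairs, so their coordinates are indexed by `Fin p × Fin 2`.
-/

namespace Sessa

noncomputable section

/-- Exact GELU: `GELU(z) = z Φ(z)` with `Φ` the standard normal distribution function. -/
def gelu (z : ℝ) : ℝ := z * ProbabilityTheory.cdf (ProbabilityTheory.gaussianReal 0 1) z

/-- RoPE frequency `ω_r = ϑ^(-2r/d_k)`, `d_k = 2 p`. -/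
def ropeFreq (ϑ : ℝ) (p : ℕ) (r : Fin p) : ℝ :=
  ϑ ^ (-(2 * ((r : ℕ) : ℝ)) / (2 * (p : ℝ)))

/-- Rotation of the pair `z^(r)` by the angle `ω_r τ`, for every `r`. -/
def rope (ϑ : ℝ) {p : ℕ} (τ : ℝ) (z : Fin p × Fin 2 → ℝ) : Fin p × Fin 2 → ℝ := fun i =>
  if i.2 = 0 then
    Real.cos (ropeFreq ϑ p i.1 * τ) * z (i.1, 0) - Real.sin (ropeFreq ϑ p i.1 * τ) * z (i.1, 1)
  else
    Real.sin (ropeFreq ϑ p i.1 * τ) * z (i.1, 0) + Real.cos (ropeFreq ϑ p i.1 * τ) * z (i.1, 1)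

/-- Softmax of the logits `l` over the finite set `S` of positions, extended by `0` outside `S`
(in particular identically `0` if `S` is empty). -/
def softmaxOn {T : ℕ} (S : Finset (Fin T)) (l : Fin T → ℝ) (j : Fin T) : ℝ :=
  if j ∈ S then Real.exp (l j) / ∑ i ∈ S, Real.exp (l i) else 0

/-- Tokenwise affine map `x_t ↦ x_t W + b`. -/
def tokenwiseAffine {T d n : ℕ} (W : Matrix (Fin d) (Fin n) ℝ) (b : Fin n → ℝ)
    (X : Matrix (Fin T) (Fin d) ℝ) : Matrix (Fin T) (Fin n) ℝ :=
  Matrix.of fun t => Matrix.vecMul (X t) W + b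

/-- Frobenius norm. -/
def frobNorm {T d : ℕ} (X : Matrix (Fin T) (Fin d) ℝ) : ℝ := √(∑ t, ∑ i, X t i ^ 2)

/-- Causality of a map defined on a set of sequences: the output token at time `t` depends only on
the input tokens at times `0, …, t`. -/
def Causal {T d n : ℕ} {𝒟 : Set (Matrix (Fin T) (Fin d) ℝ)}
    (F : 𝒟 → Matrix (Fin T) (Fin n) ℝ) : Prop :=
  ∀ (t : Fin T) (x x' : 𝒟), (∀ s ≤ t, x.1 s = x'.1 s) → F x t = F x' t

/-- The parameters of a Sessa block of model width `m` and query/key width `d_k = 2 * p`.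
The index type `Fin m ⊕ Fin m` of the input projection stands for the splitting `u = (a, g)`. -/
structure Block (p m : ℕ) where
  Win : Matrix (Fin m) (Fin m ⊕ Fin m) ℝ
  bin : Fin m ⊕ Fin m → ℝ
  Wout : Matrix (Fin m) (Fin m) ℝ
  bout : Fin m → ℝ
  WQf : Matrix (Fin m) (Fin p × Fin 2) ℝ
  WKf : Matrix (Fin m) (Fin p × Fin 2) ℝ
  WQb : Matrix (Fin m) (Fin p × Fin 2) ℝ
  WKb : Matrix (Fin m) (Fin p × Fin 2) ℝ
  WV : Matrix (Fin m) (Fin m) ℝ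
  wγ : Fin m → ℝ
  bγ : ℝ

namespace Block

variable {p m T : ℕ}

/-- The input projection of one token, `u = x W^in + b^in` (no normalization). -/
def inProj (B : Block p m) (x : Fin m → ℝ) : Fin m ⊕ Fin m → ℝ := Matrix.vecMul x B.Win + B.bin

/-- The activation `ā_t = GELU(a_t)`. -/
def act (B : Block p m) (X : Matrix (Fin T) (Fin m) ℝ) : Matrix (Fin T) (Fin m) ℝ :=
  Matrix.of fun t i => gelu (B.inProj (X t) (Sum.inl i))

/-- The gate `g_t`. -/
def gate (B : Block p m) (X : Matrix (Fin T) (Fin m) ℝ) : Matrix (Fin T) (Fin m) ℝ :=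
  Matrix.of fun t i => B.inProj (X t) (Sum.inr i)

/-- Forward attention weights over `j ≤ t`, with RoPE and scale `d_k^(-1/2)`;
`A` is the sequence of activations. -/
def fwdWeights (B : Block p m) (ϑ : ℝ) (A : Matrix (Fin T) (Fin m) ℝ) :
    Matrix (Fin T) (Fin T) ℝ :=
  Matrix.of fun t => softmaxOn (Finset.Iic t) fun j =>
    (√(2 * (p : ℝ)))⁻¹ * (rope ϑ ((t : ℕ) : ℝ) (Matrix.vecMul (A t) B.WQf) ⬝ᵥ
      rope ϑ ((j : ℕ) : ℝ) (Matrix.vecMul (A j) B.WKf))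

/-- Feedback attention weights over `j < t`, without positional encoding. -/
def fbWeights (B : Block p m) (A : Matrix (Fin T) (Fin m) ℝ) : Matrix (Fin T) (Fin T) ℝ :=
  Matrix.of fun t => softmaxOn (Finset.Iio t) fun j =>
    (√(2 * (p : ℝ)))⁻¹ * (Matrix.vecMul (A t) B.WQb ⬝ᵥ Matrix.vecMul (A j) B.WKb)

/-- The feedback gain `γ_t`. -/
def gain (B : Block p m) (A : Matrix (Fin T) (Fin m) ℝ) (t : Fin T) : ℝ :=
  Real.tanh (A t ⬝ᵥ B.wγ + B.bγ)

/-- The strictly lower triangular feedback matrix, `γ_t` times the feedback weights. -/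
def fbMatrix (B : Block p m) (A : Matrix (Fin T) (Fin m) ℝ) : Matrix (Fin T) (Fin T) ℝ :=
  Matrix.of fun t j => B.gain A t * B.fbWeights A t j

/-- The forward signal `f_t = ∑_{j ≤ t} α_{t,j} v_j`, `v_j = ā_j W_V`. -/
def fwdSignal (B : Block p m) (ϑ : ℝ) (A : Matrix (Fin T) (Fin m) ℝ) : Matrix (Fin T) (Fin m) ℝ :=
  B.fwdWeights ϑ A * (A * B.WV)

/-- The mixer output: the unique solution `s` of `(I - fbMatrix) s = fwdSignal`, see
`eq_mixer_iff` below. -/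
def mixer (B : Block p m) (ϑ : ℝ) (A : Matrix (Fin T) (Fin m) ℝ) : Matrix (Fin T) (Fin m) ℝ :=
  (1 - B.fbMatrix A)⁻¹ * B.fwdSignal ϑ A

/-- The block as a map on sequences: `y_t = x_t + ((s_t ⊙ g_t) W^out + b^out)`. -/
def eval (B : Block p m) (ϑ : ℝ) (X : Matrix (Fin T) (Fin m) ℝ) : Matrix (Fin T) (Fin m) ℝ :=
  X + tokenwiseAffine B.Wout B.bout (Matrix.hadamard (B.mixer ϑ (B.act X)) (B.gate X))

theorem isUnit_det (B : Block p m) (A : Matrix (Fin T) (Fin m) ℝ) :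
    IsUnit (1 - B.fbMatrix A).det := by
  have hz : ∀ i j : Fin T, i ≤ j → B.fbMatrix A i j = 0 := by
    intro i j h
    simp [fbMatrix, fbWeights, softmaxOn, not_lt.mpr h]
  rw [Matrix.det_of_isLowerTriangular]
  · simp [hz _ _ le_rfl]
  · intro i j h
    have h' : i < j := h
    simp [hz i j h'.le, h'.ne]

/-- The mixer output is the unique solution of the feedback system. -/
theorem eq_mixer_iff (B : Block p m) (ϑ : ℝ) (A s : Matrix (Fin T) (Fin m) ℝ) :
    s = B.mixer ϑ A ↔ (1 - B.fbMatrix A) * s = B.fwdSignal ϑ A := by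
  have h := B.isUnit_det A
  constructor
  · rintro rfl
    rw [mixer, Matrix.mul_nonsing_inv_cancel_left _ _ h]
  · intro hs
    rw [mixer, ← hs, Matrix.nonsing_inv_mul_cancel_left _ _ h]

end Block

/-- LN-free Sessa networks of width `m`, query/key width `d_k = 2 * p` and RoPE base `ϑ`:
compositions of finitely many, and at least one, Sessa blocks. -/
inductive IsNetwork (ϑ : ℝ) (p m T : ℕ) :
    (Matrix (Fin T) (Fin m) ℝ → Matrix (Fin T) (Fin m) ℝ) → Prop
  | block (B : Block p m) : IsNetwork ϑ p m T (B.eval ϑ)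
  | comp (B : Block p m) {G : Matrix (Fin T) (Fin m) ℝ → Matrix (Fin T) (Fin m) ℝ}
      (hG : IsNetwork ϑ p m T G) : IsNetwork ϑ p m T (B.eval ϑ ∘ G)

end

end Sessa

/-!
The approximating networks compute exactly; the only approximation is the Stone–Weierstrass theorem.

Since `gelu z - gelu (-z) = z`, a block with zero queries and keys and constant gain `γ` can perform
`y_t = x_t + (R u)_t • (x_t A + a)`, where `u` is an affine functional of the tokens and `R` is the
fixed operator `(1 - γ S)⁻¹ P`, with `P` and `S` averaging over `j ≤ t` and over `j < t`
(`gatedBlock_eval`).  In large width, results can be stored in channels that were zero, so the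
signals obtainable as affine functionals of a hidden state form a linear space that contains the
input coordinates and is closed under `(u, v) ↦ (R u) * v` (`Obtainable.mixer_mul`).

For `γ = 0` this is `(P u) * v`.  The matrix `P` is lower triangular with nonzero diagonal, so by
Cayley–Hamilton its inverse is a polynomial in `P`; applying the operation to `P⁻¹ u` instead of `u`
shows that obtainable signals are closed under pointwise products (`Obtainable.mul`).  Positions come
from the feedback path: for `γ = 1 / 2` the response `R 1` is strictly increasing in `t`
(`uniformMixer_half_mulVec_one`, `positionCode_strictMono`).  Interpolation at its values yields
the indicators of positions, and averaging `1_{t = j} x_t` and multiplying by `t + 1` lets every token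
`t ≥ j` recall `x_j` (`recall_mem_obtainableAlgebra`).

At output time `t`, the obtainable signals thus restrict to an algebra of continuous functions of
`x_0, …, x_t` which contains all coordinates, while causality makes the target a continuous function
of `x_0, …, x_t` on a compact set.  Stone–Weierstrass (`exists_obtainable_near`) and one last block
writing the result into the channels read by the output adapter (`exists_network_unembed_eq`)
finish the proof.
-/

namespace Sessa

open Matrix Finset

/-! ### GELU -/

/-- By the symmetry `Φ(z) + Φ(-z) = 1`, two activations carry a linear signal exactly. -/
theorem gelu_sub_gelu_neg (z : ℝ) : gelu z - gelu (-z) = z := by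
  set μ := ProbabilityTheory.gaussianReal 0 1 with hμ
  have hflip : μ.real (Set.Iic (-z)) = μ.real (Set.Ici z) := by
    have h : μ.map (fun x ↦ -x) = μ := by
      rw [hμ, ProbabilityTheory.gaussianReal_map_neg, neg_zero]
    rw [← h, MeasureTheory.map_measureReal_apply measurable_neg measurableSet_Iic, h]
    congr 1
    ext x
    simp
  have hcompl : μ.real (Set.Iic z) + μ.real (Set.Ici z) = 1 := by
    have := ProbabilityTheory.nullSingletonClass_gaussianReal (μ := 0) (v := 1) one_ne_zero
    rw [MeasureTheory.measureReal_congr (MeasureTheory.Ioi_ae_eq_Ici (μ := μ) (a := z)).symm,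
      ← Set.compl_Iic]
    exact MeasureTheory.probReal_add_probReal_compl measurableSet_Iic
  simp only [gelu, ProbabilityTheory.cdf_eq_real, ← hμ, hflip]
  linear_combination z * hcompl

/-! ### Causal averaging and constant feedback -/

/-- Uniform forward attention: row `t` averages over the positions `j ≤ t`. -/
noncomputable def causalAvg (T : ℕ) : Matrix (Fin T) (Fin T) ℝ :=
  Matrix.of fun t => softmaxOn (Finset.Iic t) fun _ => 0

/-- Uniform feedback attention: row `t` averages over the positions `j < t`, and vanishes for
`t = 0`. -/
noncomputable def strictAvg (T : ℕ) : Matrix (Fin T) (Fin T) ℝ :=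
  Matrix.of fun t => softmaxOn (Finset.Iio t) fun _ => 0

/-- The sequence operator of a mixer with uniform attention and constant feedback gain `γ`. -/
noncomputable def uniformMixer (T : ℕ) (γ : ℝ) : Matrix (Fin T) (Fin T) ℝ :=
  (1 - γ • strictAvg T)⁻¹ * causalAvg T

theorem causalAvg_apply {T : ℕ} (t j : Fin T) :
    causalAvg T t j = if j ≤ t then ((t : ℝ) + 1)⁻¹ else 0 := by
  simp [causalAvg, softmaxOn]

theorem strictAvg_apply {T : ℕ} (t j : Fin T) :
    strictAvg T t j = if j < t then (t : ℝ)⁻¹ else 0 := by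
  simp [strictAvg, softmaxOn]

theorem uniformMixer_zero (T : ℕ) : uniformMixer T 0 = causalAvg T := by
  simp [uniformMixer]

theorem causalAvg_mulVec_one (T : ℕ) : causalAvg T *ᵥ (fun _ => 1) = fun _ => 1 := by
  funext t
  have h : (t : ℝ) + 1 ≠ 0 := by positivity
  simp [mulVec, dotProduct, causalAvg_apply, ← Finset.sum_filter,
    Finset.filter_ge_eq_Iic, h]

theorem isUnit_det_causalAvg (T : ℕ) : IsUnit (causalAvg T).det := by
  rw [Matrix.det_of_isLowerTriangular, isUnit_iff_ne_zero, Finset.prod_ne_zero_iff]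
  · intro t _
    have h : (t : ℝ) + 1 ≠ 0 := by positivity
    simpa [causalAvg_apply] using h
  · intro i j h
    have h' : i < j := h
    simp [causalAvg_apply, not_le.mpr h']

theorem isUnit_det_one_sub_strictAvg (T : ℕ) (γ : ℝ) :
    IsUnit (1 - γ • strictAvg T).det := by
  rw [Matrix.det_of_isLowerTriangular]
  · simp [strictAvg_apply]
  · intro i j h
    have h' : i < j := h
    simp [strictAvg_apply, not_lt.mpr h'.le, h'.ne]

/-- The response of the mixer with feedback gain `1/2` to a constant input, in closed recursive
form. -/
noncomputable def positionCode : ℕ → ℝ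
  | 0 => 1
  | t + 1 => positionCode t + (1 - positionCode t / 2) / (t + 1)

theorem positionCode_lt_two (t : ℕ) : positionCode t < 2 := by
  induction t with
  | zero => norm_num [positionCode]
  | succ t ih =>
    have h1 : (1 - positionCode t / 2) / ((t : ℝ) + 1) ≤ 1 - positionCode t / 2 :=
      div_le_self (by linarith) (by linarith [(Nat.cast_nonneg t : (0 : ℝ) ≤ t)])
    rw [positionCode]
    linarith

theorem positionCode_strictMono : StrictMono positionCode := by
  refine strictMono_nat_of_lt_succ fun t => ?_
  have h : 0 < (1 - positionCode t / 2) / ((t : ℝ) + 1) :=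
    div_pos (by linarith [positionCode_lt_two t]) (by positivity)
  rw [positionCode]
  linarith

theorem sum_range_positionCode (t : ℕ) :
    ∑ j ∈ Finset.range t, positionCode j = 2 * t * (positionCode t - 1) := by
  induction t with
  | zero => simp
  | succ t ih =>
    have h : (t : ℝ) + 1 ≠ 0 := by positivity
    rw [Finset.sum_range_succ, ih, positionCode]
    push_cast
    field_simp
    ring

theorem uniformMixer_half_mulVec_one (T : ℕ) :
    uniformMixer T (1 / 2) *ᵥ (fun _ => 1) = fun t : Fin T => positionCode t := by
  have hsys : (1 - (1 / 2 : ℝ) • strictAvg T) *ᵥ (fun t : Fin T => positionCode t) =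
      fun _ => 1 := by
    funext t
    have hsum : ∑ j ∈ Finset.Iio t, positionCode j = 2 * t * (positionCode t - 1) := by
      rw [← sum_range_positionCode, ← Nat.Iio_eq_range, ← Fin.map_valEmbedding_Iio, Finset.sum_map]
      rfl
    have hS : (strictAvg T *ᵥ fun t : Fin T => positionCode t) t = 2 * (positionCode t - 1) := by
      simp only [mulVec, dotProduct, strictAvg_apply, ite_mul, zero_mul, ← Finset.sum_filter,
        Finset.filter_gt_eq_Iio, ← Finset.mul_sum, hsum]
      -- The row `t = 0` vanishes, and so does the right-hand side, as the code starts at `1`.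
      rcases Nat.eq_zero_or_pos (t : ℕ) with h0 | h0
      · simp [h0, positionCode]
      · have : (t : ℝ) ≠ 0 := by positivity
        field_simp
    rw [sub_mulVec, one_mulVec, smul_mulVec, Pi.sub_apply, Pi.smul_apply, hS, smul_eq_mul]
    ring
  rw [uniformMixer, ← mulVec_mulVec, causalAvg_mulVec_one, ← hsys, mulVec_mulVec,
    Matrix.nonsing_inv_mul _ (isUnit_det_one_sub_strictAvg T _), one_mulVec]

/-! ### A block computing one product -/

/-- A block with uniform attention and constant gain `tanh β`.  Its activations carry the affine
functional `w, b` of the token and its negative, from which the value projection recovers the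
functional in every coordinate; its gate is the affine map `A, a`. -/
def gatedBlock {n : ℕ} (w : Fin (n + 2) → ℝ) (b β : ℝ)
    (A : Matrix (Fin (n + 2)) (Fin (n + 2)) ℝ) (a : Fin (n + 2) → ℝ) : Block 1 (n + 2) where
  Win := Matrix.of fun k => Sum.elim (Fin.cons (w k) (Fin.cons (-w k) 0)) (A k)
  bin := Sum.elim (Fin.cons b (Fin.cons (-b) 0)) a
  Wout := 1
  bout := 0
  WQf := 0
  WKf := 0
  WQb := 0
  WKb := 0
  WV := Matrix.of fun k _ => (Fin.cons 1 (Fin.cons (-1) 0) : Fin (n + 2) → ℝ) k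
  wγ := 0
  bγ := β

theorem gatedBlock_act_mul_WV {n T : ℕ} (w : Fin (n + 2) → ℝ) (b β : ℝ)
    (A : Matrix (Fin (n + 2)) (Fin (n + 2)) ℝ) (a : Fin (n + 2) → ℝ)
    (X : Matrix (Fin T) (Fin (n + 2)) ℝ) (t : Fin T) (i : Fin (n + 2)) :
    ((gatedBlock w b β A a).act X * (gatedBlock w b β A a).WV) t i = X t ⬝ᵥ w + b := by
  have h0 : (gatedBlock w b β A a).act X t 0 = gelu (X t ⬝ᵥ w + b) := by
    simp [Block.act, Block.inProj, gatedBlock, vecMul, dotProduct]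
  have h1 : (gatedBlock w b β A a).act X t 1 = gelu (-(X t ⬝ᵥ w + b)) := by
    simp only [Block.act, Block.inProj, gatedBlock, vecMul, dotProduct, Matrix.of_apply,
      Pi.add_apply, Sum.elim_inl]
    congr 1
    rw [← Fin.succ_zero_eq_one]
    simp
    ring
  rw [Matrix.mul_apply, Fin.sum_univ_succ, Fin.sum_univ_succ, Fin.succ_zero_eq_one, h0, h1]
  have h := gelu_sub_gelu_neg (X t ⬝ᵥ w + b)
  simp only [gatedBlock, Matrix.of_apply, Fin.cons_zero, Fin.cons_succ, ← Fin.succ_zero_eq_one]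
  simp [-neg_add_rev]
  linarith

theorem gatedBlock_eval {n T : ℕ} (ϑ : ℝ) (w : Fin (n + 2) → ℝ) (b β : ℝ)
    (A : Matrix (Fin (n + 2)) (Fin (n + 2)) ℝ) (a : Fin (n + 2) → ℝ)
    (X : Matrix (Fin T) (Fin (n + 2)) ℝ) (t : Fin T) (i : Fin (n + 2)) :
    (gatedBlock w b β A a).eval ϑ X t i =
      X t i + (uniformMixer T (Real.tanh β) *ᵥ fun j => X j ⬝ᵥ w + b) t *
        (vecMul (X t) A i + a i) := by
  have hfw : (gatedBlock w b β A a).fwdWeights ϑ ((gatedBlock w b β A a).act X) =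
      causalAvg T := by
    ext t j
    simp [Block.fwdWeights, causalAvg, gatedBlock, rope, dotProduct]
  have hfb : (gatedBlock w b β A a).fbMatrix ((gatedBlock w b β A a).act X) =
      Real.tanh β • strictAvg T := by
    ext t j
    simp [Block.fbMatrix, Block.fbWeights, Block.gain, strictAvg, gatedBlock]
  have hmix : (gatedBlock w b β A a).mixer ϑ ((gatedBlock w b β A a).act X) t i =
      (uniformMixer T (Real.tanh β) *ᵥ fun j => X j ⬝ᵥ w + b) t := by
    rw [Block.mixer, Block.fwdSignal, hfw, hfb, ← Matrix.mul_assoc, ← uniformMixer,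
      Matrix.mul_apply]
    simp only [gatedBlock_act_mul_WV, mulVec, dotProduct]
  have hgate : (gatedBlock w b β A a).gate X t i = vecMul (X t) A i + a i := rfl
  have hout : tokenwiseAffine (gatedBlock w b β A a).Wout (gatedBlock w b β A a).bout
      (Matrix.hadamard ((gatedBlock w b β A a).mixer ϑ ((gatedBlock w b β A a).act X))
        ((gatedBlock w b β A a).gate X)) =
      Matrix.hadamard ((gatedBlock w b β A a).mixer ϑ ((gatedBlock w b β A a).act X))
        ((gatedBlock w b β A a).gate X) := by
    ext t i
    simp [tokenwiseAffine, gatedBlock]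
  rw [Block.eval, hout, Matrix.add_apply, Matrix.hadamard_apply, hmix, hgate]

/-! ### Sequence functions obtainable by networks -/

/-- Real-valued signals along the sequence, as functions of the input sequence. -/
abbrev Signal (T D : ℕ) : Type := Matrix (Fin T) (Fin D) ℝ → Fin T → ℝ

/-- The coordinate embedding `ℝ^D → ℝ^m` for `D ≤ m`, padding with zeros. -/
def padMatrix (D m : ℕ) : Matrix (Fin D) (Fin m) ℝ :=
  Matrix.of fun i k => if (i : ℕ) = k then 1 else 0

theorem vecMul_padMatrix {D m : ℕ} (v : Fin D → ℝ) (k : Fin m) :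
    vecMul v (padMatrix D m) k = if h : (k : ℕ) < D then v ⟨k, h⟩ else 0 := by
  simp only [vecMul, dotProduct, padMatrix, Matrix.of_apply, mul_ite, mul_one, mul_zero]
  split_ifs with h
  · rw [Finset.sum_eq_single_of_mem (⟨k, h⟩ : Fin D) (Finset.mem_univ _)]
    · simp
    · intro i _ hi
      rw [if_neg fun hik => hi (Fin.ext hik)]
  · exact Finset.sum_eq_zero fun i _ => if_neg (by omega)

theorem vecMul_padMatrix_transpose {D m : ℕ} (hDm : D ≤ m) (v : Fin m → ℝ) (i : Fin D) :
    vecMul v (padMatrix D m)ᵀ i = v (Fin.castLE hDm i) := by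
  simp only [vecMul, dotProduct, padMatrix, Matrix.transpose_apply, Matrix.of_apply, mul_ite,
    mul_one, mul_zero]
  rw [Finset.sum_eq_single_of_mem (Fin.castLE hDm i) (Finset.mem_univ _)]
  · simp
  · intro k _ hk
    rw [if_neg fun hik => hk (Fin.ext hik.symm)]

/-- The zero-padding token embedding. -/
abbrev embed {T D : ℕ} (m : ℕ) (x : Matrix (Fin T) (Fin D) ℝ) : Matrix (Fin T) (Fin m) ℝ :=
  tokenwiseAffine (padMatrix D m) 0 x

/-- The input coordinate `i` as a signal. -/
def coordSignal {T D : ℕ} (i : Fin D) : Signal T D := fun x t => x t i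

/-- The signals that are affine functionals of the channels `c`. -/
noncomputable def affineSpan {T D : ℕ} (c : ℕ → Signal T D) : Submodule ℝ (Signal T D) :=
  Submodule.span ℝ (insert 1 (Set.range c))

/-- The channels `c`, of which those from `N` on vanish, are the hidden state of a network in
every sufficiently large width (at least `2`, as needed by `gatedBlock`), and they retain the input
up to an affine map.  Asking for all large widths lets later steps claim fresh channels. -/
structure Realizable (ϑ : ℝ) {T D : ℕ} (N : ℕ) (c : ℕ → Signal T D) : Prop where
  le : D ≤ N
  eq_zero : ∀ i, N ≤ i → c i = 0
  coord_mem : ∀ i : Fin D, coordSignal i ∈ affineSpan c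
  exists_network : ∀ n, N ≤ n + 2 → ∃ G, IsNetwork ϑ 1 (n + 2) T G ∧
    ∀ x t (i : Fin (n + 2)), G (embed (n + 2) x) t i = c i x t

variable {ϑ : ℝ} {T D : ℕ}

theorem exists_affine_of_mem_affineSpan {N m : ℕ} {c : ℕ → Signal T D}
    (hc : ∀ i, N ≤ i → c i = 0) (hm : N ≤ m) {u : Signal T D} (hu : u ∈ affineSpan c) :
    ∃ (w : Fin m → ℝ) (b : ℝ), ∀ x t, u x t = (fun i : Fin m => c i x t) ⬝ᵥ w + b := by
  induction hu using Submodule.span_induction with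
  | mem u hu =>
    rcases hu with rfl | ⟨k, rfl⟩
    · exact ⟨0, 1, fun x t => by simp⟩
    · by_cases hk : k < m
      · exact ⟨Pi.single ⟨k, hk⟩ 1, 0, fun x t => by simp⟩
      · exact ⟨0, 0, fun x t => by simp [hc k (by omega)]⟩
  | zero => exact ⟨0, 0, fun x t => by simp⟩
  | add u v _ _ hu hv =>
    obtain ⟨w, b, h⟩ := hu
    obtain ⟨w', b', h'⟩ := hv
    refine ⟨w + w', b + b', fun x t => ?_⟩
    rw [Pi.add_apply, Pi.add_apply, h, h', dotProduct_add]
    ring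
  | smul r u _ hu =>
    obtain ⟨w, b, h⟩ := hu
    refine ⟨r • w, r * b, fun x t => ?_⟩
    rw [Pi.smul_apply, Pi.smul_apply, h, dotProduct_smul, smul_eq_mul, smul_eq_mul]
    ring

theorem one_mem_affineSpan (c : ℕ → Signal T D) : 1 ∈ affineSpan c :=
  Submodule.subset_span (Set.mem_insert _ _)

theorem mem_affineSpan (c : ℕ → Signal T D) (k : ℕ) : c k ∈ affineSpan c :=
  Submodule.subset_span (Set.mem_insert_of_mem _ ⟨k, rfl⟩)

theorem realizable_input (ϑ : ℝ) (T D : ℕ) :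
    Realizable ϑ D fun k : ℕ => if h : k < D then (coordSignal ⟨k, h⟩ : Signal T D) else 0 where
  le := le_rfl
  eq_zero i hi := dif_neg (by omega)
  coord_mem i := by
    have h := mem_affineSpan
      (fun k : ℕ => if h : k < D then (coordSignal ⟨k, h⟩ : Signal T D) else 0) i
    simpa using h
  exists_network n _ := by
    refine ⟨_, IsNetwork.block (gatedBlock 0 0 0 0 0), fun x t i => ?_⟩
    have h := vecMul_padMatrix (x t) i
    rw [gatedBlock_eval]
    simp only [tokenwiseAffine, Matrix.of_apply, Pi.add_apply, h]
    split_ifs <;> simp [coordSignal]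

/-- A block can write the product of a mixed signal with an affine functional of the current token
into a channel that was zero. -/
theorem Realizable.update {N : ℕ} {c : ℕ → Signal T D} (hc : Realizable ϑ N c) (β : ℝ)
    {u v : Signal T D} (hu : u ∈ affineSpan c) (hv : v ∈ affineSpan c) :
    Realizable ϑ (N + 1)
      (Function.update c N fun x t => (uniformMixer T (Real.tanh β) *ᵥ u x) t * v x t) ∧
    affineSpan c ≤ affineSpan
      (Function.update c N fun x t => (uniformMixer T (Real.tanh β) *ᵥ u x) t * v x t) := by
  set c' := Function.update c N
    fun x t => (uniformMixer T (Real.tanh β) *ᵥ u x) t * v x t with hc'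
  have hle : affineSpan c ≤ affineSpan c' := by
    refine Submodule.span_le.mpr (Set.insert_subset (one_mem_affineSpan _) ?_)
    rintro _ ⟨k, rfl⟩
    rcases eq_or_ne k N with rfl | hk
    · rw [hc.eq_zero k le_rfl]
      exact zero_mem _
    · have h := mem_affineSpan c' k
      rwa [hc', Function.update_of_ne hk] at h
  refine ⟨⟨hc.le.trans N.le_succ, fun i hi => ?_, fun i => hle (hc.coord_mem i), fun n hn => ?_⟩,
    hle⟩
  · rw [hc', Function.update_of_ne (by omega), hc.eq_zero i (by omega)]
  · obtain ⟨G, hG, hGc⟩ := hc.exists_network n (by omega)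
    obtain ⟨w, b, hw⟩ := exists_affine_of_mem_affineSpan hc.eq_zero (show N ≤ n + 2 by omega) hu
    obtain ⟨w', b', hw'⟩ := exists_affine_of_mem_affineSpan hc.eq_zero (show N ≤ n + 2 by omega) hv
    refine ⟨_, .comp (gatedBlock w b β (Matrix.of fun k i => if (i : ℕ) = N then w' k else 0)
      fun i => if (i : ℕ) = N then b' else 0) hG, fun x t i => ?_⟩
    have hrow : ∀ t, G (embed (n + 2) x) t = fun i : Fin (n + 2) => c i x t :=
      fun t => funext (hGc x t)
    rw [Function.comp_apply, gatedBlock_eval]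
    simp only [hrow, ← hw]
    by_cases hi : (i : ℕ) = N
    · rw [hc', hi, Function.update_self, hc.eq_zero N le_rfl, hw']
      simp [vecMul, dotProduct, hi]
    · rw [hc', Function.update_of_ne hi]
      simp [vecMul, dotProduct, hi]

/-- A signal is obtainable if every hidden state can be extended, without losing information, to
one of which the signal is an affine functional. -/
def Obtainable (ϑ : ℝ) {T D : ℕ} (a : Signal T D) : Prop :=
  ∀ N c, Realizable ϑ N c → ∃ N' c', Realizable ϑ N' c' ∧ affineSpan c ≤ affineSpan c' ∧
    a ∈ affineSpan c'

theorem obtainable_one : Obtainable ϑ (1 : Signal T D) :=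
  fun N c hc => ⟨N, c, hc, le_rfl, one_mem_affineSpan c⟩

theorem obtainable_coordSignal (i : Fin D) : Obtainable ϑ (coordSignal i : Signal T D) :=
  fun N c hc => ⟨N, c, hc, le_rfl, hc.coord_mem i⟩

theorem Obtainable.smul {a : Signal T D} (ha : Obtainable ϑ a) (r : ℝ) :
    Obtainable ϑ (r • a) := fun N c hc =>
  let ⟨N', c', hc', hle, h⟩ := ha N c hc
  ⟨N', c', hc', hle, Submodule.smul_mem _ r h⟩

theorem Obtainable.exists_pair {a a' : Signal T D} (ha : Obtainable ϑ a) (ha' : Obtainable ϑ a')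
    {N : ℕ} {c : ℕ → Signal T D} (hc : Realizable ϑ N c) :
    ∃ N' c', Realizable ϑ N' c' ∧ affineSpan c ≤ affineSpan c' ∧
      a ∈ affineSpan c' ∧ a' ∈ affineSpan c' := by
  obtain ⟨N₁, c₁, hc₁, hle₁, h₁⟩ := ha N c hc
  obtain ⟨N₂, c₂, hc₂, hle₂, h₂⟩ := ha' N₁ c₁ hc₁
  exact ⟨N₂, c₂, hc₂, hle₁.trans hle₂, hle₂ h₁, h₂⟩

theorem Obtainable.add {a a' : Signal T D} (ha : Obtainable ϑ a) (ha' : Obtainable ϑ a') :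
    Obtainable ϑ (a + a') := fun _ _ hc =>
  let ⟨N', c', hc', hle, h, h'⟩ := ha.exists_pair ha' hc
  ⟨N', c', hc', hle, add_mem h h'⟩

theorem Obtainable.mixer_mul {u v : Signal T D} (hu : Obtainable ϑ u) (hv : Obtainable ϑ v)
    (β : ℝ) :
    Obtainable ϑ fun x t => (uniformMixer T (Real.tanh β) *ᵥ u x) t * v x t := by
  intro N c hc
  obtain ⟨N₁, c₁, hc₁, hle₁, h, h'⟩ := hu.exists_pair hv hc
  obtain ⟨hr, hle₂⟩ := hc₁.update β h h'
  refine ⟨_, _, hr, hle₁.trans hle₂, ?_⟩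
  have hmem := mem_affineSpan (Function.update c₁ N₁
    fun x t => (uniformMixer T (Real.tanh β) *ᵥ u x) t * v x t) N₁
  rwa [Function.update_self] at hmem

/-- Finitely many obtainable signals are affine functionals of a common hidden state. -/
theorem exists_realizable_of_obtainable {ι : Type*} [Finite ι] {b : ι → Signal T D}
    (hb : ∀ i, Obtainable ϑ (b i)) :
    ∃ N c, Realizable ϑ N c ∧ ∀ i, b i ∈ affineSpan c := by
  classical
  have := Fintype.ofFinite ι
  suffices h : ∀ s : Finset ι, ∃ N c, Realizable ϑ N c ∧ ∀ i ∈ s, b i ∈ affineSpan c by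
    simpa using h Finset.univ
  intro s
  induction s using Finset.induction_on with
  | empty => exact ⟨_, _, realizable_input ϑ T D, by simp⟩
  | insert i s _ ih =>
    obtain ⟨N, c, hc, hs⟩ := ih
    obtain ⟨N', c', hc', hle, hi⟩ := hb i N c hc
    refine ⟨N', c', hc', fun j hj => ?_⟩
    rcases Finset.mem_insert.mp hj with rfl | hj
    · exact hi
    · exact hle (hs j hj)

/-! ### The algebra of obtainable signals -/

theorem Obtainable.causalAvg_mul {u v : Signal T D} (hu : Obtainable ϑ u)
    (hv : Obtainable ϑ v) : Obtainable ϑ fun x t => (causalAvg T *ᵥ u x) t * v x t := by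
  simpa [uniformMixer_zero] using hu.mixer_mul hv 0

theorem Obtainable.causalAvg {u : Signal T D} (hu : Obtainable ϑ u) :
    Obtainable ϑ fun x => Sessa.causalAvg T *ᵥ u x := by
  simpa using hu.causalAvg_mul obtainable_one

/-- An invertible matrix has a polynomial in the matrix as its inverse. -/
theorem exists_inv_eq_aeval {n R : Type*} [Fintype n] [DecidableEq n] [Field R]
    {M : Matrix n n R} (hM : IsUnit M.det) :
    ∃ q : Polynomial R, M⁻¹ = Polynomial.aeval M q := by
  have h0 : M.charpoly.coeff 0 ≠ 0 := by
    intro h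
    rw [Matrix.det_eq_sign_charpoly_coeff, h, mul_zero] at hM
    exact not_isUnit_zero hM
  refine ⟨Polynomial.C (-(M.charpoly.coeff 0)⁻¹) * M.charpoly.divX, ?_⟩
  have h := congrArg (Polynomial.aeval M) (Polynomial.divX_mul_X_add M.charpoly)
  rw [Matrix.aeval_self_charpoly, map_add, map_mul, Polynomial.aeval_X, Polynomial.aeval_C,
    Algebra.algebraMap_eq_smul_one] at h
  refine Matrix.inv_eq_left_inv ?_
  rw [map_mul, Polynomial.aeval_C, Algebra.algebraMap_eq_smul_one, smul_mul_assoc, one_mul,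
    smul_mul_assoc, eq_neg_of_add_eq_zero_left h, smul_neg, neg_smul, neg_neg, smul_smul,
    inv_mul_cancel₀ h0, one_smul]

/-- Causal averaging can be undone, its inverse being a polynomial in it. -/
theorem Obtainable.causalAvg_inv {u : Signal T D} (hu : Obtainable ϑ u) :
    Obtainable ϑ fun x => (Sessa.causalAvg T)⁻¹ *ᵥ u x := by
  obtain ⟨q, hq⟩ := exists_inv_eq_aeval (isUnit_det_causalAvg T)
  rw [hq]
  clear hq
  induction q using Polynomial.induction_on' with
  | add p q hp hq =>
    simp only [map_add, add_mulVec]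
    exact hp.add hq
  | monomial n r =>
    have hpow : Obtainable ϑ fun x => Sessa.causalAvg T ^ n *ᵥ u x := by
      induction n with
      | zero => simpa using hu
      | succ n ih =>
        simp only [pow_succ', ← mulVec_mulVec]
        exact ih.causalAvg
    simp only [Polynomial.aeval_monomial, Algebra.algebraMap_eq_smul_one, smul_mul_assoc, one_mul,
      smul_mulVec]
    exact hpow.smul r

/-- Feeding the mixer the preimage of `u` under causal averaging gives the pointwise product. -/
theorem Obtainable.mul {u v : Signal T D} (hu : Obtainable ϑ u) (hv : Obtainable ϑ v) :
    Obtainable ϑ (u * v) := by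
  have h := hu.causalAvg_inv.causalAvg_mul hv
  simp only [mulVec_mulVec, Matrix.mul_nonsing_inv _ (isUnit_det_causalAvg T), one_mulVec] at h
  exact h

/-- The obtainable signals form an algebra under pointwise operations. -/
def obtainableAlgebra (ϑ : ℝ) (T D : ℕ) : Subalgebra ℝ (Signal T D) where
  carrier := {a | Obtainable ϑ a}
  mul_mem' := Obtainable.mul
  add_mem' := Obtainable.add
  algebraMap_mem' r := by
    rw [Algebra.algebraMap_eq_smul_one]
    exact obtainable_one.smul r

/-- The feedback recursion responds to a constant input with pairwise different values, which makes
absolute positions available. -/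
theorem positionCode_mem_obtainableAlgebra :
    (fun _ t => positionCode t : Signal T D) ∈ obtainableAlgebra ϑ T D := by
  have h : Obtainable ϑ fun x t => (uniformMixer T (Real.tanh (Real.artanh (1 / 2))) *ᵥ
      (1 : Signal T D) x) t * (1 : Signal T D) x t :=
    obtainable_one.mixer_mul obtainable_one _
  have h1 (x : Matrix (Fin T) (Fin D) ℝ) : (1 : Signal T D) x = fun _ => 1 := rfl
  simp only [Real.tanh_artanh (show (1 / 2 : ℝ) ∈ Set.Ioo (-1) 1 by norm_num), h1, mul_one,
    uniformMixer_half_mulVec_one] at h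
  exact h

/-- The indicator of a position, by Lagrange interpolation at the position codes. -/
theorem indicator_mem_obtainableAlgebra (j : Fin T) :
    (fun _ t => if t = j then 1 else 0 : Signal T D) ∈ obtainableAlgebra ϑ T D := by
  have h : (∏ k ∈ Finset.univ.erase j, (positionCode j - positionCode k)⁻¹ •
      ((fun _ t => positionCode t : Signal T D) - algebraMap ℝ (Signal T D) (positionCode k))) ∈
      obtainableAlgebra ϑ T D :=
    prod_mem fun k _ => Subalgebra.smul_mem _
      (sub_mem positionCode_mem_obtainableAlgebra (Subalgebra.algebraMap_mem _ _)) _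
  convert h using 1
  funext x t
  simp only [Finset.prod_apply, Pi.smul_apply, Pi.sub_apply, Pi.algebraMap_apply,
    Algebra.algebraMap_self, RingHom.id_apply, smul_eq_mul]
  split_ifs with htj
  · subst htj
    refine (Finset.prod_eq_one fun k hk => inv_mul_cancel₀ (sub_ne_zero.mpr fun hkt => ?_)).symm
    exact Finset.ne_of_mem_erase hk (Fin.ext (positionCode_strictMono.injective hkt)).symm
  · exact (Finset.prod_eq_zero (Finset.mem_erase.mpr ⟨htj, Finset.mem_univ t⟩) (by simp)).symm

theorem position_mem_obtainableAlgebra (q : Fin T → ℝ) :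
    (fun _ t => q t : Signal T D) ∈ obtainableAlgebra ϑ T D := by
  have h : (∑ j, q j • (fun _ t => if t = j then 1 else 0 : Signal T D)) ∈
      obtainableAlgebra ϑ T D :=
    sum_mem fun j _ => Subalgebra.smul_mem _ (indicator_mem_obtainableAlgebra j) _
  convert h using 1
  funext x t
  simp

/-- From position `j` on, every token can recall the input token at position `j`. -/
theorem recall_mem_obtainableAlgebra (j : Fin T) (i : Fin D) :
    (fun x t => if j ≤ t then x j i else 0 : Signal T D) ∈ obtainableAlgebra ϑ T D := by
  have h1 : (fun _ t => if t = j then 1 else 0 : Signal T D) * coordSignal i ∈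
      obtainableAlgebra ϑ T D :=
    mul_mem (indicator_mem_obtainableAlgebra j) (obtainable_coordSignal i)
  have h2 : (fun x => causalAvg T *ᵥ
      ((fun _ t => if t = j then 1 else 0 : Signal T D) * coordSignal i : Signal T D) x) ∈
      obtainableAlgebra ϑ T D := Obtainable.causalAvg h1
  have h3 := mul_mem (position_mem_obtainableAlgebra (ϑ := ϑ) (D := D)
    fun t : Fin T => (t : ℝ) + 1) h2
  convert h3 using 1
  funext x t
  have h : (t : ℝ) + 1 ≠ 0 := by positivity
  simp [mulVec, dotProduct, causalAvg_apply, coordSignal, h]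

/-! ### Approximation of causal maps -/

/-- The input sequence with all tokens after time `t` replaced by zero. -/
def truncateAfter (t : Fin T) (x : Matrix (Fin T) (Fin D) ℝ) : Matrix (Fin T) (Fin D) ℝ :=
  Matrix.of fun j i => if j ≤ t then x j i else 0

theorem continuous_truncateAfter (t : Fin T) :
    Continuous (truncateAfter t : Matrix (Fin T) (Fin D) ℝ → _) := by
  refine continuous_matrix fun j i => ?_
  simp only [truncateAfter, Matrix.of_apply]
  split_ifs
  · exact continuous_id.matrix_elem j i
  · exact continuous_const

/-- By causality the output at time `t` descends to a continuous function of the truncated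
input; there the obtainable signals, evaluated at time `t`, contain all coordinates, and the
Stone–Weierstrass theorem applies. -/
theorem exists_obtainable_near {𝒟 : Set (Matrix (Fin T) (Fin D) ℝ)} (h𝒟 : IsCompact 𝒟)
    {F : 𝒟 → Matrix (Fin T) (Fin D) ℝ} (hF : Continuous F) (hFc : Causal F) {δ : ℝ} (hδ : 0 < δ)
    (t : Fin T) (i : Fin D) :
    ∃ a ∈ obtainableAlgebra ϑ T D, ∀ x : 𝒟, |a x.1 t - F x t i| < δ := by
  have : CompactSpace 𝒟 := isCompact_iff_compactSpace.mp h𝒟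
  have htc : Continuous fun x : 𝒟 => truncateAfter t x.1 :=
    (continuous_truncateAfter t).comp continuous_subtype_val
  let K := Set.range fun x : 𝒟 => truncateAfter t x.1
  have : CompactSpace K := isCompact_iff_compactSpace.mp (isCompact_range htc)
  let π : C(𝒟, K) := ⟨Set.rangeFactorization _, htc.subtype_mk _⟩
  have hπ : Topology.IsQuotientMap π :=
    .of_surjective_continuous Set.rangeFactorization_surjective π.continuous
  let f : C(𝒟, ℝ) := ⟨fun x => F x t i, hF.matrix_elem t i⟩
  have hfac : Function.FactorsThrough f π := by
    intro x x' h
    refine congrFun (hFc t x x' fun s hs => ?_) i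
    have hs' : truncateAfter t x.1 s = truncateAfter t x'.1 s :=
      congrFun (congrArg Subtype.val h) s
    funext k
    simpa [truncateAfter, hs] using congrFun hs' k
  let S : Subalgebra ℝ C(K, ℝ) :=
    { carrier := {g | ∃ a ∈ obtainableAlgebra ϑ T D, ∀ x : 𝒟, a x.1 t = g (π x)}
      mul_mem' := by
        rintro g g' ⟨a, ha, h⟩ ⟨a', ha', h'⟩
        exact ⟨a * a', mul_mem ha ha', fun x => by simp [h, h']⟩
      add_mem' := by
        rintro g g' ⟨a, ha, h⟩ ⟨a', ha', h'⟩
        exact ⟨a + a', add_mem ha ha', fun x => by simp [h, h']⟩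
      algebraMap_mem' := fun r =>
        ⟨algebraMap ℝ _ r, Subalgebra.algebraMap_mem _ r, fun x => by simp⟩ }
  have hS : S.SeparatesPoints := by
    intro y y' hne
    obtain ⟨j, k, hjk⟩ : ∃ j k, y.1 j k ≠ y'.1 j k := by
      by_contra! h
      exact hne (Subtype.ext (Matrix.ext h))
    let g : C(K, ℝ) := ⟨fun y => y.1 j k, continuous_subtype_val.matrix_elem j k⟩
    exact ⟨g, ⟨g, ⟨_, recall_mem_obtainableAlgebra j k, fun x => rfl⟩, rfl⟩, hjk⟩
  obtain ⟨⟨g, a, ha, hag⟩, hg⟩ :=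
    ContinuousMap.exists_mem_subalgebra_near_continuous_of_separatesPoints S hS
      (hπ.lift f hfac) (hπ.lift f hfac).continuous δ hδ
  refine ⟨a, ha, fun x => ?_⟩
  have hlift : hπ.lift f hfac (π x) = F x t i := DFunLike.congr_fun (hπ.lift_comp f hfac) x
  have h := hg (π x)
  rwa [hlift, ← hag, Real.norm_eq_abs] at h

/-- The approximants for the single output times are glued by position indicators. -/
theorem exists_obtainable_near_forall {𝒟 : Set (Matrix (Fin T) (Fin D) ℝ)} (h𝒟 : IsCompact 𝒟)
    {F : 𝒟 → Matrix (Fin T) (Fin D) ℝ} (hF : Continuous F) (hFc : Causal F) {δ : ℝ} (hδ : 0 < δ)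
    (i : Fin D) :
    ∃ a : Signal T D, Obtainable ϑ a ∧ ∀ (x : 𝒟) t, |a x.1 t - F x t i| < δ := by
  choose a ha hnear using fun t => exists_obtainable_near (ϑ := ϑ) h𝒟 hF hFc hδ t i
  have hmem : (∑ j, (fun _ t => if t = j then 1 else 0 : Signal T D) * a j) ∈
      obtainableAlgebra ϑ T D :=
    sum_mem fun j _ => mul_mem (indicator_mem_obtainableAlgebra j) (ha j)
  refine ⟨_, hmem, fun x t => ?_⟩
  simpa using hnear t x

/-- The last block replaces the first `D` channels by the prescribed signals; since the block is
residual, the gate supplies the difference. -/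
theorem exists_network_unembed_eq {b : Fin D → Signal T D} (hb : ∀ i, Obtainable ϑ (b i)) :
    ∃ n, D ≤ n + 2 ∧ ∃ G, IsNetwork ϑ 1 (n + 2) T G ∧
      ∀ x t i, tokenwiseAffine (padMatrix D (n + 2))ᵀ 0 (G (embed (n + 2) x)) t i = b i x t := by
  obtain ⟨N, c, hc, hbc⟩ := exists_realizable_of_obtainable hb
  have hD : D ≤ N + 2 := hc.le.trans (Nat.le_add_right _ _)
  obtain ⟨G, hG, hGc⟩ := hc.exists_network N (Nat.le_add_right _ _)
  choose w r hw using fun i =>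
    exists_affine_of_mem_affineSpan (m := N + 2) hc.eq_zero (Nat.le_add_right _ _) (hbc i)
  -- The affine functional `0, 1` makes the mixer output identically `1`.
  refine ⟨N, hD, _, .comp (gatedBlock 0 1 0
    ((Matrix.of fun k l : Fin (N + 2) => if h : (l : ℕ) < D then w ⟨l, h⟩ k else 0) - 1)
    fun l => if h : (l : ℕ) < D then r ⟨l, h⟩ else 0) hG, fun x t i => ?_⟩
  have hrow : G (embed (N + 2) x) t = fun i : Fin (N + 2) => c i x t := funext (hGc x t)
  have hpad (X : Matrix (Fin T) (Fin (N + 2)) ℝ) :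
      tokenwiseAffine (padMatrix D (N + 2))ᵀ 0 X t i = X t (Fin.castLE hD i) := by
    simp [tokenwiseAffine, vecMul_padMatrix_transpose hD]
  rw [hpad, Function.comp_apply, gatedBlock_eval, hrow, hw]
  simp only [dotProduct_zero, zero_add, Real.tanh_zero, uniformMixer_zero, causalAvg_mulVec_one,
    one_mul, vecMul_sub, vecMul_one, Pi.sub_apply]
  simp [vecMul, dotProduct]
  ring

theorem frobNorm_le_of_abs_le {X : Matrix (Fin T) (Fin D) ℝ} {δ : ℝ} (hδ : 0 ≤ δ)
    (h : ∀ t i, |X t i| ≤ δ) : frobNorm X ≤ (T * D + 1) * δ := by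
  refine Real.sqrt_le_iff.mpr ⟨by positivity, ?_⟩
  calc ∑ t, ∑ i, X t i ^ 2 ≤ ∑ _t : Fin T, ∑ _i : Fin D, δ ^ 2 := by
        refine Finset.sum_le_sum fun t _ => Finset.sum_le_sum fun i _ => ?_
        exact sq_le_sq' (abs_le.mp (h t i)).1 (abs_le.mp (h t i)).2
    _ = (T * D : ℝ) * δ ^ 2 := by simp [mul_assoc]
    _ ≤ ((T * D : ℝ) + 1) ^ 2 * δ ^ 2 := by
        gcongr
        nlinarith [show (0 : ℝ) ≤ T * D by positivity]
    _ = ((T * D + 1) * δ) ^ 2 := by ring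

end Sessa

/-- Universal approximation of continuous causal maps by concrete LN-free Sessa networks with
tokenwise affine adapters, at query/key width `d_k = 2` (one rotary pair). -/
theorem mainTheorem4 (T D : ℕ) (ϑ : ℝ) (hϑ : 1 < ϑ)
    (𝒟 : Set (Matrix (Fin T) (Fin D) ℝ)) (h𝒟 : IsCompact 𝒟)
    (F : 𝒟 → Matrix (Fin T) (Fin D) ℝ) (hF : Continuous F) (hFc : Sessa.Causal F)
    (ε : ℝ) (hε : 0 < ε) :
    ∃ m : ℕ, 1 ≤ m ∧ D ≤ m ∧
      ∃ (Wemb : Matrix (Fin D) (Fin m) ℝ) (bemb : Fin m → ℝ)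
        (Wun : Matrix (Fin m) (Fin D) ℝ) (bun : Fin D → ℝ)
        (G : Matrix (Fin T) (Fin m) ℝ → Matrix (Fin T) (Fin m) ℝ),
        (∀ x : Matrix (Fin T) (Fin D) ℝ,
          Sessa.tokenwiseAffine Wun bun (Sessa.tokenwiseAffine Wemb bemb x) = x) ∧
        Sessa.IsNetwork ϑ 1 m T G ∧
        (⨆ x : 𝒟, ENNReal.ofReal (Sessa.frobNorm
          (F x - Sessa.tokenwiseAffine Wun bun (G (Sessa.tokenwiseAffine Wemb bemb x.1))))) <
            ENNReal.ofReal ε := by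
  have hδ : 0 < ε / 2 / (T * D + 1) := by positivity
  choose b hb hnear using fun i =>
    Sessa.exists_obtainable_near_forall (ϑ := ϑ) h𝒟 hF hFc hδ i
  obtain ⟨n, hD, G, hG, hGb⟩ := Sessa.exists_network_unembed_eq hb
  refine ⟨n + 2, by omega, hD, Sessa.padMatrix D (n + 2), 0,
    (Sessa.padMatrix D (n + 2)).transpose, 0, G, fun x => ?_, hG, ?_⟩
  · ext t i
    simp [Sessa.tokenwiseAffine, Sessa.vecMul_padMatrix_transpose hD, Sessa.vecMul_padMatrix]
  · refine lt_of_le_of_lt (iSup_le fun x => ENNReal.ofReal_le_ofReal ?_)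
      ((ENNReal.ofReal_lt_ofReal_iff hε).mpr (half_lt_self hε))
    have h := Sessa.frobNorm_le_of_abs_le (X := F x - Sessa.tokenwiseAffine
      (Sessa.padMatrix D (n + 2)).transpose 0 (G (Sessa.embed (n + 2) x.1))) hδ.le fun t i => by
        rw [Matrix.sub_apply, hGb, abs_sub_comm]
        exact (hnear i x t).le
    rwa [mul_div_cancel₀ _ (by positivity)] at h
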